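/- Let $\Lambda\subset\mathbb{R}^4$ be a full-rank lattice with dual lattice $\Lambda^*=\{y\in\mathbb{R}^4 : \langle x,y\rangle\in\mathbb{Z}\text{ for all }x\in\Lambda\}$. Suppose that $\Lambda$ is integral ($\Lambda\subset\Lambda^*$), even ($\langle x,x\rangle\in 2\mathbb{Z}$ for all $x\in\Lambda$), and of level $2$, i.e. $2$ is the least positive integer $N$ such that $N\langle y,y\rangle\in 2\mathbb{Z}$ for all $y\in\Lambda^*$. Then there is an orthogonal transformation $\sigma\in O(\mathbb{R}^4)$ such that $\Lambda=\sigma(D_4)$, where $$D_4=\{(x_1,x_2,x_3,x_4)\in\mathbb{Z}^4 : x_1+x_2+x_3+x_4\equiv 0 \pmod 2\}.$$ -/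

import Mathlib

/-- The dual lattice `Λ* = {y | ⟨x, y⟩ ∈ ℤ for all x ∈ Λ}`. -/
def dualLattice {d : ℕ} (Λ : Submodule ℤ (EuclideanSpace ℝ (Fin d))) :
    Submodule ℤ (EuclideanSpace ℝ (Fin d)) where
  carrier := {y | ∀ x ∈ Λ, ∃ n : ℤ, inner ℝ x y = (n : ℝ)}
  zero_mem' := fun x _ => ⟨0, by simp⟩
  add_mem' := by
    intro y z hy hz x hx
    obtain ⟨m, hm⟩ := hy x hx
    obtain ⟨n, hn⟩ := hz x hx
    exact ⟨m + n, by rw [inner_add_right, hm, hn]; push_cast; rfl⟩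
  smul_mem' := by
    intro c y hy x hx
    obtain ⟨m, hm⟩ := hy x hx
    refine ⟨c * m, ?_⟩
    rw [← Int.cast_smul_eq_zsmul ℝ c y, inner_smul_right, hm]
    push_cast
    rfl

/-- `Λ` is integral: it is contained in its dual lattice. -/
def IsIntegralLattice {d : ℕ} (Λ : Submodule ℤ (EuclideanSpace ℝ (Fin d))) : Prop :=
  Λ ≤ dualLattice Λ

/-- `Λ` is even: `⟨x, x⟩ ∈ 2ℤ` for all `x ∈ Λ`. -/
def IsEvenLattice {d : ℕ} (Λ : Submodule ℤ (EuclideanSpace ℝ (Fin d))) : Prop :=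
  ∀ x ∈ Λ, ∃ k : ℤ, inner ℝ x x = 2 * (k : ℝ)

/-- `Λ` has level `N`: `N` is the minimum of all positive integers `M` such that
`M ⟨y, y⟩ ∈ 2ℤ` for all `y` in the dual lattice. -/
def HasLevel {d : ℕ} (Λ : Submodule ℤ (EuclideanSpace ℝ (Fin d))) (N : ℕ) : Prop :=
  IsLeast {M : ℕ | 0 < M ∧ ∀ y ∈ dualLattice Λ, ∃ k : ℤ, (M : ℝ) * inner ℝ y y = 2 * (k : ℝ)} N

/-- The `D₄` lattice: the integer vectors in `ℝ⁴` with even coordinate sum. -/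
def D4Lattice : Submodule ℤ (EuclideanSpace ℝ (Fin 4)) where
  carrier := {x | ∃ n : Fin 4 → ℤ, (∀ i, x i = (n i : ℝ)) ∧ n 0 + n 1 + n 2 + n 3 ≡ 0 [ZMOD 2]}
  zero_mem' := ⟨0, by simp, by simp⟩
  add_mem' := by
    rintro x y ⟨m, hm, hm2⟩ ⟨n, hn, hn2⟩
    refine ⟨m + n, fun i => by simp [hm i, hn i], ?_⟩
    simp only [Int.ModEq, Pi.add_apply] at *
    omega
  smul_mem' := by
    rintro c x ⟨m, hm, hm2⟩
    refine ⟨fun i => c * m i, fun i => by simp [hm i], ?_⟩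
    have h := hm2.mul_left c
    simpa [mul_add] using h

/-! Level 2 makes `⟨y, y⟩` an integer for every `y ∈ Λ*`. The key claim is that `Λ*` contains an
orthonormal basis of `ℝ⁴`, built one vector at a time by Minkowski's theorem
(`exists_unit_mem_dualLattice_orthogonal`). In the coordinates of that basis `Λ` consists of integer
vectors, and evenness puts it inside `D₄`. Conversely, polarization and integral norms force `Λ*`
into `D₄*`, whence `D₄ ⊆ Λ** = Λ`. -/

theorem Module.Basis.exists_dual_inner {ι E : Type*} [Finite ι] [DecidableEq ι]
    [NormedAddCommGroup E] [InnerProductSpace ℝ E] (b : Module.Basis ι ℝ E) :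
    ∃ c : Module.Basis ι ℝ E, ∀ i j, inner ℝ (b i) (c j) = if i = j then (1 : ℝ) else 0 := by
  have hB : LinearMap.BilinForm.Nondegenerate (innerₗ E) := by
    constructor
    · intro x hx
      exact inner_self_eq_zero.1 (hx x)
    · intro x hx
      exact inner_self_eq_zero.1 (hx x)
  refine ⟨LinearMap.BilinForm.dualBasis (innerₗ E) hB b, fun i j => ?_⟩
  rw [real_inner_comm]
  exact LinearMap.BilinForm.apply_dualBasis_left hB b j i

section

variable {d : ℕ} {ι : Type*} [Fintype ι] [DecidableEq ι]
  {b c : Module.Basis ι ℝ (EuclideanSpace ℝ (Fin d))}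

theorem repr_eq_inner_dual (hbc : ∀ i j, inner ℝ (b i) (c j) = if i = j then (1 : ℝ) else 0)
    (x : EuclideanSpace ℝ (Fin d)) (j : ι) : b.repr x j = inner ℝ x (c j) := by
  conv_rhs => rw [← b.sum_repr x, sum_inner]
  simp only [real_inner_smul_left, hbc]
  simp

/-- The dual of the lattice spanned by a basis is spanned by the dual basis. -/
theorem dualLattice_span (hbc : ∀ i j, inner ℝ (b i) (c j) = if i = j then (1 : ℝ) else 0) :
    dualLattice (Submodule.span ℤ (Set.range b)) = Submodule.span ℤ (Set.range c) := by
  have hcb : ∀ i j, inner ℝ (c i) (b j) = if i = j then (1 : ℝ) else 0 := by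
    intro i j
    rw [real_inner_comm, hbc]
    simp [eq_comm]
  apply le_antisymm
  · intro y hy
    rw [c.mem_span_iff_repr_mem ℤ]
    intro i
    obtain ⟨n, hn⟩ := hy (b i) (Submodule.subset_span ⟨i, rfl⟩)
    refine ⟨n, ?_⟩
    rw [repr_eq_inner_dual hcb, real_inner_comm, hn]
    simp
  · rw [Submodule.span_le]
    rintro _ ⟨i, rfl⟩ x hx
    rw [b.mem_span_iff_repr_mem ℤ] at hx
    obtain ⟨n, hn⟩ := hx i
    refine ⟨n, ?_⟩
    rw [← repr_eq_inner_dual hbc, ← hn]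
    simp

end

section

variable {d : ℕ} (L : Submodule ℤ (EuclideanSpace ℝ (Fin d))) [DiscreteTopology L] [IsZLattice ℝ L]

theorem exists_basis_dual_basis :
    ∃ b c : Module.Basis (Fin d) ℝ (EuclideanSpace ℝ (Fin d)),
      (∀ i j, inner ℝ (b i) (c j) = if i = j then (1 : ℝ) else 0) ∧
      Submodule.span ℤ (Set.range b) = L ∧ Submodule.span ℤ (Set.range c) = dualLattice L := by
  have := ZLattice.module_free ℝ L
  have := ZLattice.module_finite ℝ L
  have hr : Module.finrank ℤ L = d := by rw [ZLattice.rank ℝ L]; simp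
  let b₀ : Module.Basis (Fin d) ℤ L := Module.finBasisOfFinrankEq ℤ L hr
  obtain ⟨c, hc⟩ := (b₀.ofZLatticeBasis ℝ L).exists_dual_inner
  have hb := b₀.ofZLatticeBasis_span ℝ L
  refine ⟨b₀.ofZLatticeBasis ℝ L, c, hc, hb, ?_⟩
  rw [← dualLattice_span hc, hb]

theorem dualLattice_dualLattice : dualLattice (dualLattice L) = L := by
  obtain ⟨b, c, hbc, hb, hc⟩ := exists_basis_dual_basis L
  rw [← hc, dualLattice_span (b := c) (c := b), hb]
  intro i j
  rw [real_inner_comm, hbc]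
  simp [eq_comm]

theorem discreteTopology_dualLattice : DiscreteTopology (dualLattice L) := by
  obtain ⟨b, c, hbc, hb, hc⟩ := exists_basis_dual_basis L
  rw [← hc]
  infer_instance

open MeasureTheory in
/-- Minkowski's theorem for the dual of an integral lattice, whose covolume is at most one. -/
theorem exists_ne_zero_mem_dualLattice (hL : IsIntegralLattice L)
    {s : Set (EuclideanSpace ℝ (Fin d))} (hsymm : ∀ x ∈ s, -x ∈ s) (hconv : Convex ℝ s)
    (hvol : 2 ^ d < volume s) : ∃ x ∈ dualLattice L, x ≠ 0 ∧ x ∈ s := by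
  obtain ⟨b, c, hbc, hb, hc⟩ := exists_basis_dual_basis L
  let e := EuclideanSpace.basisFun (Fin d) ℝ
  have hP : (e.toBasis.toMatrix b).transpose * e.toBasis.toMatrix c = 1 := by
    ext i j
    rw [Matrix.one_apply, ← hbc i j, PiLp.inner_apply]
    simp [Matrix.mul_apply, Module.Basis.toMatrix_apply, e, mul_comm]
  have hG : ∃ n : ℤ, (e.toBasis.toMatrix b).det * (e.toBasis.toMatrix b).det = n := by
    have h : ∀ i j, ∃ n : ℤ, inner ℝ (b i) (b j) = (n : ℝ) := fun i j =>
      hL (hb ▸ Submodule.subset_span ⟨j, rfl⟩) (b i) (hb ▸ Submodule.subset_span ⟨i, rfl⟩)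
    choose n hn using h
    refine ⟨(Matrix.of n).det, ?_⟩
    have hmat : (e.toBasis.toMatrix b).transpose * e.toBasis.toMatrix b =
        (Matrix.of n).map (Int.castRingHom ℝ) := by
      ext i j
      rw [Matrix.map_apply, Matrix.of_apply, eq_intCast, ← hn i j, PiLp.inner_apply]
      simp [Matrix.mul_apply, Module.Basis.toMatrix_apply, e, mul_comm]
    have h1 := congrArg Matrix.det hmat
    rw [Matrix.det_mul, Matrix.det_transpose] at h1
    rw [h1]
    exact ((Int.castRingHom ℝ).map_det _).symm
  -- The Gram determinant `(det b)²` is a positive integer, hence at least 1, and `det c` is the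
  -- inverse of `det b`.
  have hdet : |e.toBasis.det c| ≤ 1 := by
    rw [Module.Basis.det_apply]
    have h1 := congrArg Matrix.det hP
    rw [Matrix.det_mul, Matrix.det_transpose, Matrix.det_one] at h1
    obtain ⟨n, hn⟩ := hG
    have hne : (e.toBasis.toMatrix b).det ≠ 0 := left_ne_zero_of_mul (h1 ▸ one_ne_zero)
    have hpos : (0 : ℝ) < n := hn ▸ mul_self_pos.2 hne
    have hn1 : (1 : ℝ) ≤ n := by exact_mod_cast Int.cast_pos.1 hpos
    have h2 : (n : ℝ) * ((e.toBasis.toMatrix c).det) ^ 2 = 1 := by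
      rw [← hn]; linear_combination
        (1 + (e.toBasis.toMatrix b).det * (e.toBasis.toMatrix c).det) * h1
    rw [← sq_le_one_iff_abs_le_one]
    nlinarith [sq_nonneg (e.toBasis.toMatrix c).det]
  have hfd : volume (ZSpan.fundamentalDomain c) ≤ 1 := by
    rw [ZSpan.measure_fundamentalDomain c volume e.toBasis,
      measure_congr (ZSpan.fundamentalDomain_ae_parallelepiped e.toBasis volume),
      OrthonormalBasis.coe_toBasis, OrthonormalBasis.volume_parallelepiped, mul_one]
    exact ENNReal.ofReal_le_one.2 hdet
  have hcount : Countable (Submodule.span ℤ (Set.range c)).toAddSubgroup :=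
    inferInstanceAs (Countable (Submodule.span ℤ (Set.range c)))
  obtain ⟨x, hx0, hx⟩ := exists_ne_zero_mem_lattice_of_measure_mul_two_pow_lt_measure
    (L := (Submodule.span ℤ (Set.range c)).toAddSubgroup)
    (ZSpan.isAddFundamentalDomain c volume) hsymm hconv (by
      refine lt_of_le_of_lt ?_ hvol
      simpa using mul_le_mul_left hfd (2 ^ d))
  exact ⟨x, hc ▸ x.2, by simpa using hx0, hx⟩

end

/-! ### Cylinders: volume and convexity -/

open MeasureTheory in
/-- The volume of the product of a cube of side `2` and a Euclidean ball. -/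
theorem OrthonormalBasis.volume_cube_inter_cylinder {E : Type*} [NormedAddCommGroup E]
    [InnerProductSpace ℝ E] [MeasurableSpace E] [BorelSpace E] [FiniteDimensional ℝ E] {j k : ℕ}
    (b : OrthonormalBasis (Fin j ⊕ Fin k) ℝ E) {r : ℝ} (hr : 0 < r) :
    volume {x : E | (∀ i, |inner ℝ (b (Sum.inl i)) x| < 1) ∧
      ∑ i, inner ℝ (b (Sum.inr i)) x ^ 2 < r ^ 2} =
      2 ^ j * volume (Metric.ball (0 : EuclideanSpace ℝ (Fin k)) r) := by
  have hf := (((MeasurePreserving.id (volume : Measure (Fin j → ℝ))).prod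
    (PiLp.volume_preserving_toLp (Fin k))).comp
    (volume_measurePreserving_sumPiEquivProdPi (fun _ : Fin j ⊕ Fin k => ℝ))).comp
    ((PiLp.volume_preserving_ofLp (Fin j ⊕ Fin k)).comp b.measurePreserving_repr)
  have hball : MeasurableSet (Metric.ball (0 : EuclideanSpace ℝ (Fin k)) r) := measurableSet_ball
  have hcube : MeasurableSet (Set.univ.pi fun _ : Fin j => Set.Ioo (-1 : ℝ) 1) :=
    MeasurableSet.univ_pi fun _ => measurableSet_Ioo
  have h := hf.measure_preimage (hcube.prod hball).nullMeasurableSet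
  rw [Measure.prod_prod, volume_pi_pi] at h
  simp only [Real.volume_Ioo, Finset.prod_const, Finset.card_univ, Fintype.card_fin] at h
  norm_num at h
  rw [← h]
  congr 1
  ext x
  simp [MeasurableEquiv.coe_sumPiEquivProdPi, EuclideanSpace.norm_eq, Real.sqrt_lt' hr, abs_lt,
    OrthonormalBasis.repr_apply_apply]

open MeasureTheory in
-- Radius `√2` is chosen so that an integral norm `⟨w, w⟩ < 2` must be 1. For `k = 1, 2, 3, 4` the
-- volumes are `16√2`, `8π`, `16√2π/3` and `2π²`; `π > 3` and `√2 > 1.4` suffice.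
theorem two_pow_four_lt_volume_cylinder {j k : ℕ} (hjk : j + k = 4) (hk : 0 < k) :
    (2 : ENNReal) ^ 4 < 2 ^ j * volume (Metric.ball (0 : EuclideanSpace ℝ (Fin k)) (√2)) := by
  have hπ := Real.pi_gt_three
  have hs : (1.4 : ℝ) < √2 := Real.lt_sqrt_of_sq_lt (by norm_num)
  have h2 : √2 ^ 2 = (2 : ℝ) := Real.sq_sqrt (by norm_num)
  have key : ∀ (m : ℕ) (c : ℝ), 0 ≤ c → (16 : ℝ) < 2 ^ j * (√2 ^ m * c) →
      (2 : ENNReal) ^ 4 < 2 ^ j * (ENNReal.ofReal (√2) ^ m * ENNReal.ofReal c) := by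
    intro m c hc h
    have h' := (ENNReal.ofReal_lt_ofReal_iff (lt_trans (by norm_num) h)).2 h
    rw [ENNReal.ofReal_mul (by positivity), ENNReal.ofReal_mul (by positivity),
      ENNReal.ofReal_pow (by positivity), ENNReal.ofReal_pow (by positivity)] at h'
    norm_num at h' ⊢
    exact h'
  obtain rfl | rfl | rfl | rfl : k = 1 ∨ k = 2 ∨ k = 3 ∨ k = 4 := by omega
  · obtain rfl : j = 3 := by omega
    rw [InnerProductSpace.volume_ball_of_dim_odd (k := 0) (by simp)]
    simp only [finrank_euclideanSpace, Fintype.card_fin]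
    apply key
    · positivity
    · norm_num [Nat.doubleFactorial]
      linarith
  · obtain rfl : j = 2 := by omega
    rw [EuclideanSpace.volume_ball_fin_two]
    apply key
    · positivity
    · rw [h2]
      linarith
  · obtain rfl : j = 1 := by omega
    rw [EuclideanSpace.volume_ball_fin_three]
    apply key
    · positivity
    · rw [pow_succ (√2) 2, h2]
      nlinarith
  · obtain rfl : j = 0 := by omega
    rw [InnerProductSpace.volume_ball_of_dim_even (k := 2) (by simp)]
    simp only [finrank_euclideanSpace, Fintype.card_fin]
    apply key
    · positivity
    · rw [show √2 ^ 4 = (√2 ^ 2) ^ 2 by ring, h2]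
      norm_num
      nlinarith

theorem convex_cube_inter_cylinder {E α β : Type*} [NormedAddCommGroup E] [InnerProductSpace ℝ E]
    [Fintype β] (v : α → E) (w : β → E) (r s : ℝ) :
    Convex ℝ {x : E | (∀ i, |inner ℝ (v i) x| < r) ∧ ∑ i, inner ℝ (w i) x ^ 2 < s} := by
  have hlin : ∀ u : E, ConvexOn ℝ Set.univ fun x => |inner ℝ u x| := fun u =>
    (convexOn_norm (E := ℝ) convex_univ).comp_linearMap (innerₗ E u)
  have hsq : ∀ u : E, ConvexOn ℝ Set.univ fun x => inner ℝ u x ^ 2 := fun u =>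
    (even_two.convexOn_pow (𝕜 := ℝ)).comp_linearMap (innerₗ E u)
  have h1 : Convex ℝ (⋂ i, {x : E | x ∈ Set.univ ∧ |inner ℝ (v i) x| < r}) :=
    convex_iInter fun i => (hlin (v i)).convex_lt r
  have h2 : ConvexOn ℝ Set.univ fun x => ∑ i, inner ℝ (w i) x ^ 2 := by
    refine ⟨convex_univ, fun x hx y hy a b ha hb hab => ?_⟩
    rw [smul_eq_mul, smul_eq_mul, Finset.mul_sum, Finset.mul_sum, ← Finset.sum_add_distrib]
    exact Finset.sum_le_sum fun i _ => (hsq (w i)).2 hx hy ha hb hab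
  convert h1.inter (h2.convex_lt s) using 1
  ext x
  simp

theorem mem_dualLattice_sup_span {d : ℕ} {ι : Type*} (L : Submodule ℤ (EuclideanSpace ℝ (Fin d)))
    (v : ι → EuclideanSpace ℝ (Fin d)) (y : EuclideanSpace ℝ (Fin d)) :
    y ∈ dualLattice (L ⊔ Submodule.span ℤ (Set.range v)) ↔
      y ∈ dualLattice L ∧ ∀ i, ∃ n : ℤ, inner ℝ (v i) y = (n : ℝ) := by
  refine ⟨fun h => ⟨fun x hx => h x (Submodule.mem_sup_left hx), fun i =>
    h (v i) (Submodule.mem_sup_right (Submodule.subset_span ⟨i, rfl⟩))⟩, fun ⟨h, hv⟩ x hx => ?_⟩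
  have hle : L ⊔ Submodule.span ℤ (Set.range v) ≤ dualLattice (Submodule.span ℤ {y}) := by
    have mem : ∀ z : EuclideanSpace ℝ (Fin d), (∃ n : ℤ, inner ℝ z y = (n : ℝ)) →
        z ∈ dualLattice (Submodule.span ℤ {y}) := by
      rintro z ⟨n, hn⟩ x hx
      obtain ⟨a, rfl⟩ := Submodule.mem_span_singleton.1 hx
      refine ⟨a * n, ?_⟩
      rw [← Int.cast_smul_eq_zsmul ℝ, real_inner_smul_left, real_inner_comm, hn]
      push_cast
      rfl
    refine sup_le (fun z hz => mem z (h z hz)) (Submodule.span_le.2 ?_)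
    rintro _ ⟨i, rfl⟩
    exact mem _ (hv i)
  obtain ⟨n, hn⟩ := hle hx y (Submodule.mem_span_singleton_self y)
  exact ⟨n, by rw [real_inner_comm, hn]⟩

/-! ### An orthonormal basis inside the dual lattice -/

section

variable {Λ : Submodule ℤ (EuclideanSpace ℝ (Fin 4))} [DiscreteTopology Λ] [IsZLattice ℝ Λ]

open MeasureTheory in
/-- If the dual of an integral lattice in `ℝ⁴` has integral norms, then every orthonormal family in
the dual of fewer than four vectors can be enlarged. -/
theorem exists_unit_mem_dualLattice_orthogonal (hint : IsIntegralLattice Λ)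
    (hnorm : ∀ y ∈ dualLattice Λ, ∃ n : ℤ, inner ℝ y y = (n : ℝ)) {j : ℕ} (hj : j < 4)
    {v : Fin j → EuclideanSpace ℝ (Fin 4)} (hv : Orthonormal ℝ v) (hvΛ : ∀ i, v i ∈ dualLattice Λ) :
    ∃ w ∈ dualLattice Λ, inner ℝ w w = (1 : ℝ) ∧ ∀ i, inner ℝ (v i) w = (0 : ℝ) := by
  obtain ⟨k, hjk⟩ := Nat.exists_eq_add_of_lt hj
  replace hjk : j + (k + 1) = 4 := by omega
  -- Adjoining `v` to `Λ` keeps it integral, so Minkowski still applies to the dual, whose vectors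
  -- now pair integrally with each `v i`.
  have hsub : Λ ⊔ Submodule.span ℤ (Set.range v) ≤ dualLattice Λ := by
    refine sup_le hint (Submodule.span_le.2 ?_)
    rintro _ ⟨i, rfl⟩
    exact hvΛ i
  have hdisc : DiscreteTopology (Λ ⊔ Submodule.span ℤ (Set.range v) : Submodule ℤ _) :=
    have := discreteTopology_dualLattice Λ
    DiscreteTopology.of_subset (s := (dualLattice Λ : Set _)) this hsub
  have hlat : IsZLattice ℝ (Λ ⊔ Submodule.span ℤ (Set.range v)) := by
    refine ⟨top_unique ?_⟩
    rw [← IsZLattice.span_top (K := ℝ) (L := Λ)]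
    exact Submodule.span_mono (SetLike.coe_subset_coe.2 le_sup_left)
  have hU : IsIntegralLattice (Λ ⊔ Submodule.span ℤ (Set.range v)) := by
    refine sup_le (fun x hx => ?_) (Submodule.span_le.2 ?_)
    · refine (mem_dualLattice_sup_span _ _ _).2 ⟨hint hx, fun i => ?_⟩
      obtain ⟨n, hn⟩ := hvΛ i x hx
      exact ⟨n, by rw [real_inner_comm, hn]⟩
    · rintro _ ⟨i, rfl⟩
      refine (mem_dualLattice_sup_span _ _ _).2 ⟨hvΛ i, fun l => ⟨if l = i then 1 else 0, ?_⟩⟩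
      rw [orthonormal_iff_ite.1 hv]
      push_cast
      rfl
  obtain ⟨b, hb⟩ : ∃ b : OrthonormalBasis (Fin j ⊕ Fin (k + 1)) ℝ (EuclideanSpace ℝ (Fin 4)),
      ∀ i, b (Sum.inl i) = v i := by
    obtain ⟨b, hb⟩ := Orthonormal.exists_orthonormalBasis_extension_of_card_eq
      (𝕜 := ℝ) (E := EuclideanSpace ℝ (Fin 4)) (ι := Fin j ⊕ Fin (k + 1)) (by simp [hjk])
      (v := Sum.elim v 0) (s := Set.range Sum.inl) (by
        have h := hv.comp (fun x : Set.range (Sum.inl : Fin j → Fin j ⊕ Fin (k + 1)) => x.2.choose)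
          (fun x y hxy => Subtype.ext (by
            rw [← x.2.choose_spec, ← y.2.choose_spec]; exact congrArg _ hxy))
        have heq : (Set.range Sum.inl).domRestrict (Sum.elim v (0 : Fin (k + 1) → _)) =
            v ∘ fun x : Set.range (Sum.inl : Fin j → Fin j ⊕ Fin (k + 1)) => x.2.choose := by
          ext1 x
          rw [Set.domRestrict_apply, ← x.2.choose_spec]
          rfl
        rw [heq]
        exact h)
    exact ⟨b, fun i => hb _ ⟨i, rfl⟩⟩
  obtain ⟨w, hw, hw0, hw1, hw2⟩ := exists_ne_zero_mem_dualLattice _ hU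
    (s := {x | (∀ i, |inner ℝ (b (Sum.inl i)) x| < 1) ∧
      ∑ i, inner ℝ (b (Sum.inr i)) x ^ 2 < √2 ^ 2})
    (fun x hx => by simpa using hx) (convex_cube_inter_cylinder _ _ _ _) (by
      rw [b.volume_cube_inter_cylinder (by positivity)]
      exact two_pow_four_lt_volume_cylinder hjk k.succ_pos)
  rw [mem_dualLattice_sup_span] at hw
  -- These products are integers, and the cube bounds them strictly by 1.
  have horth : ∀ i, inner ℝ (v i) w = (0 : ℝ) := by
    intro i
    obtain ⟨n, hn⟩ := hw.2 i
    have h := hw1 i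
    rw [hb, hn] at h
    have : n = 0 := Int.abs_lt_one_iff.1 (by exact_mod_cast h)
    rw [hn, this, Int.cast_zero]
  refine ⟨w, hw.1, ?_, horth⟩
  obtain ⟨n, hn⟩ := hnorm w hw.1
  have hlt : inner ℝ w w < (2 : ℝ) := by
    rw [real_inner_self_eq_norm_sq, ← b.sum_sq_norm_inner_right, Fintype.sum_sum_type]
    rw [Real.sq_sqrt zero_le_two] at hw2
    simpa [hb, horth] using hw2
  have hpos : 0 < inner ℝ w w := real_inner_self_pos.2 hw0
  rw [hn] at hlt hpos ⊢
  have h1 : n < 2 := by exact_mod_cast hlt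
  have h2 : 0 < n := by exact_mod_cast hpos
  obtain rfl : n = 1 := by omega
  simp

theorem exists_orthonormalBasis_mem_dualLattice (hint : IsIntegralLattice Λ)
    (hnorm : ∀ y ∈ dualLattice Λ, ∃ n : ℤ, inner ℝ y y = (n : ℝ)) :
    ∃ b : OrthonormalBasis (Fin 4) ℝ (EuclideanSpace ℝ (Fin 4)), ∀ i, b i ∈ dualLattice Λ := by
  have h : ∀ j ≤ 4, ∃ v : Fin j → EuclideanSpace ℝ (Fin 4),
      Orthonormal ℝ v ∧ ∀ i, v i ∈ dualLattice Λ := by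
    intro j
    induction j with
    | zero => exact fun _ => ⟨Fin.elim0, ⟨fun i => i.elim0, fun i => i.elim0⟩, fun i => i.elim0⟩
    | succ j ih =>
      intro hj
      obtain ⟨v, hv, hvΛ⟩ := ih (by omega)
      obtain ⟨w, hw, hw1, hvw⟩ := exists_unit_mem_dualLattice_orthogonal hint hnorm hj hv hvΛ
      have hwv : ∀ i, inner ℝ w (v i) = (0 : ℝ) := fun i => by rw [real_inner_comm, hvw]
      refine ⟨Fin.snoc v w, ?_, fun i => ?_⟩
      · rw [orthonormal_iff_ite] at hv ⊢
        intro i l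
        induction i using Fin.lastCases <;> induction l using Fin.lastCases <;>
          simp [hv, hw1, hvw, hwv, Fin.castSucc_ne_last, (Fin.castSucc_ne_last _).symm,
            -inner_self_eq_norm_sq_to_K]
      · induction i using Fin.lastCases <;> simp [hw, hvΛ]
  obtain ⟨v, hv, hvΛ⟩ := h 4 le_rfl
  obtain ⟨b, hb⟩ := Orthonormal.exists_orthonormalBasis_extension_of_card_eq
    (𝕜 := ℝ) (E := EuclideanSpace ℝ (Fin 4)) (ι := Fin 4) (by simp) (v := v) (s := Set.univ)
    (hv.comp _ Subtype.val_injective)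
  exact ⟨b, fun i => hb i trivial ▸ hvΛ i⟩

end

/-! ### Identification with `D₄` -/

/-- Squares are 0 or 1 mod 4, so the number of odd entries is 0 or 4. -/
theorem emod_two_eq_of_four_dvd_sum_sq {m : Fin 4 → ℤ} (h : 4 ∣ ∑ i, m i ^ 2) (i : Fin 4) :
    m i % 2 = m 0 % 2 := by
  have hsq : ∀ a : ℤ, a % 2 = 0 ∧ a ^ 2 % 4 = 0 ∨ a % 2 = 1 ∧ a ^ 2 % 4 = 1 := by
    intro a
    obtain ⟨c, rfl | rfl⟩ := Int.even_or_odd' a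
    · left; ring_nf; omega
    · right; ring_nf; omega
  rw [Fin.sum_univ_four] at h
  have h0 := hsq (m 0)
  have h1 := hsq (m 1)
  have h2 := hsq (m 2)
  have h3 := hsq (m 3)
  fin_cases i <;> simp only [Fin.zero_eta, Fin.mk_one, Fin.reduceFinMk] <;> omega

theorem theorem7p2
    (Λ : Submodule ℤ (EuclideanSpace ℝ (Fin 4))) [DiscreteTopology Λ] [IsZLattice ℝ Λ]
    (hint : IsIntegralLattice Λ) (heven : IsEvenLattice Λ) (hlevel : HasLevel Λ 2) :
    ∃ σ : EuclideanSpace ℝ (Fin 4) ≃ₗᵢ[ℝ] EuclideanSpace ℝ (Fin 4),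
      (Λ : Set (EuclideanSpace ℝ (Fin 4))) = σ '' (D4Lattice : Set (EuclideanSpace ℝ (Fin 4))) := by
  have hnorm : ∀ y ∈ dualLattice Λ, ∃ n : ℤ, inner ℝ y y = (n : ℝ) := by
    intro y hy
    obtain ⟨k, hk⟩ := hlevel.1.2 y hy
    exact ⟨k, by push_cast at hk; linarith⟩
  obtain ⟨b, hb⟩ := exists_orthonormalBasis_mem_dualLattice hint hnorm
  refine ⟨b.repr.symm, ?_⟩
  rw [LinearIsometryEquiv.image_eq_preimage_symm, LinearIsometryEquiv.symm_symm]
  ext x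
  rw [Set.mem_preimage, SetLike.mem_coe, SetLike.mem_coe]
  constructor
  · intro hx
    have hn : ∀ i, ∃ n : ℤ, b.repr x i = n := by
      intro i
      obtain ⟨n, hn⟩ := hb i x hx
      exact ⟨n, by rw [b.repr_apply_apply, real_inner_comm, hn]⟩
    choose n hn using hn
    refine ⟨n, hn, ?_⟩
    obtain ⟨k, hk⟩ := heven x hx
    have hsum : ∑ i, n i ^ 2 = 2 * k := by
      rw [← b.repr.inner_map_map, PiLp.inner_apply] at hk
      simp only [hn, Real.inner_apply, ← pow_two] at hk
      exact_mod_cast hk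
    have hsq : ∀ a : ℤ, a ^ 2 % 2 = a % 2 := by
      intro a
      obtain ⟨c, rfl | rfl⟩ := Int.even_or_odd' a <;> ring_nf <;> omega
    rw [Fin.sum_univ_four] at hsum
    have h0 := hsq (n 0)
    have h1 := hsq (n 1)
    have h2 := hsq (n 2)
    have h3 := hsq (n 3)
    simp only [Int.ModEq]
    omega
  · rintro ⟨n, hn, hpar⟩
    rw [← dualLattice_dualLattice Λ]
    intro z hz
    -- Polarization: `b i`, `z` and `b i + z` all lie in `Λ*` and have integral norms.
    have hm : ∀ i, ∃ m : ℤ, 2 * b.repr z i = m := by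
      intro i
      obtain ⟨p, hp⟩ := hnorm _ (add_mem (hb i) hz)
      obtain ⟨q, hq⟩ := hnorm _ hz
      refine ⟨p - q - 1, ?_⟩
      have h1 : inner ℝ (b i) (b i) = (1 : ℝ) := by
        rw [real_inner_self_eq_norm_sq, b.norm_eq_one, one_pow]
      rw [inner_add_add_self, h1, hq, real_inner_comm (b i) z] at hp
      rw [b.repr_apply_apply]
      push_cast
      linarith
    choose m hm using hm
    have hsum : 4 ∣ ∑ i, m i ^ 2 := by
      obtain ⟨q, hq⟩ := hnorm z hz
      refine ⟨q, ?_⟩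
      rw [← b.repr.inner_map_map, PiLp.inner_apply] at hq
      simp only [Real.inner_apply, ← pow_two] at hq
      have : (∑ i, (m i : ℝ) ^ 2) = 4 * q := by
        simp only [← hm, ← hq, Finset.mul_sum, mul_pow]
        norm_num
      exact_mod_cast this
    have hmod := emod_two_eq_of_four_dvd_sum_sq hsum
    -- All `m i` share the parity of `m 0`, so the sum is `m 0 * ∑ n i` mod 2, and `∑ n i` is even.
    have hdvd : (2 : ℤ) ∣ ∑ i, m i * n i := by
      have h : ∑ i, m i * n i ≡ ∑ i, m 0 * n i [ZMOD 2] :=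
        Int.ModEq.sum fun i _ => Int.ModEq.mul_right _ (hmod i)
      rw [← Finset.mul_sum, Fin.sum_univ_four n] at h
      exact Int.modEq_zero_iff_dvd.1 (h.trans (by simpa using hpar.mul_left (m 0)))
    obtain ⟨t, ht⟩ := hdvd
    refine ⟨t, ?_⟩
    rw [← b.repr.inner_map_map, PiLp.inner_apply]
    have : ∑ i, (m i : ℝ) * n i = 2 * t := by exact_mod_cast ht
    simp only [← hm, ← hn, mul_assoc, ← Finset.mul_sum] at this
    simp only [Real.inner_apply]
    linarith
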